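/- Graphs may have loops and multiple edges. A (trivalent) ribbon graph is a finite graph all of whose vertices have degree 3, together with a cyclic order of the three half-edges at each vertex; a cycle (a nonempty closed path without backtracking) then turns left or right at each vertex it passes and so carries a word in $L=\begin{pmatrix}1&1\\0&1\end{pmatrix}$ and $R=\begin{pmatrix}1&0\\1&1\end{pmatrix}$, whose trace is the trace of the product matrix. A circuit is a cycle that meets every vertex and every edge at most once; an oriented circuit is a circuit for which it is prescribed at each vertex whether one turns left or right when traversing it in a given direction, so that it carries a word as well. A closed path is essential if it is not null-homotopic, and peripheral if it is freely homotopic to a cycle consisting of left turns only, or of right turns only. A cusp of a ribbon graph is a cycle, run through once, that consists of left turns only; the number of triangles around it is its length. For $m\ge 1$ let $N(m)=\sum_{j=3}^{m}n(j)$, where $n(j)$ is the (finite) number of elements of trace $j$ in the semigroup generated by $L$ and $R$. Let $\phi=(1+\sqrt5)/2$. Theorem 4.1. Let $k\ge 3$, and let $H=(V,E)$ be a finite oriented graph in which every connected component is an oriented circuit, such that (1) each circuit in $H$ has trace at least $k$, and (2) the number of vertices of $H$ is even and at least $2N(k-2)+4k-4$. Then $H$ can be completed, by adding edges only and respecting the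 orientation of the circuits, to a trivalent ribbon graph $H'$ with vertex set $V$ such that every essential non-peripheral cycle in $H'$ carries a word of trace at least $k$, the girth of $H'$ (the length of a shortest circuit) satisfies $$h(H')\ \ge\ \log_\phi(k-1)$$ (so $h(H')\ge(1-o(1))\log_\phi k$ as $k\to\infty$, uniformly in $H$), and every cusp of $H'$ has at least $k$ triangles around it. -/

import Mathlib

/-- The direction in which a path turns at a vertex. -/
inductive Turn where
  | left
  | right
  deriving DecidableEq

namespace Turn

/-- The matrices `L` (left turn) and `R` (right turn). -/
def mat : Turn → Matrix (Fin 2) (Fin 2) ℤ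
  | left => !![1, 1; 0, 1]
  | right => !![1, 0; 1, 1]

/-- The trace of a word in `L` and `R`, that is, of the product of its letters. -/
def wordTrace (w : List Turn) : ℤ := (w.map mat).prod.trace

/-- `n(m)`: the number of elements of trace `m` of the semigroup of matrices generated by `L` and
`R` (a finite number for `m ≥ 3`). -/
noncomputable def traceCount (m : ℕ) : ℕ :=
  {A : Matrix (Fin 2) (Fin 2) ℤ |
    A ∈ Subsemigroup.closure {mat left, mat right} ∧ A.trace = m}.ncard

/-- `N(m) = n(3) + n(4) + ⋯ + n(m)`. -/
noncomputable def traceCountSum (m : ℕ) : ℕ := ∑ j ∈ Finset.Icc 3 m, traceCount j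

end Turn

/-- An oriented graph with vertex set `V` and all degrees at most three (loops and multiple edges
allowed). Every vertex `v` has three slots `(v, 0)`, `(v, 1)`, `(v, 2)` for half-edges, in this
counterclockwise cyclic order. A slot `d` with `mate d = d` is empty; otherwise the slot `d` is
filled by a half-edge, and `d` and `mate d` are the two halves of one edge. -/
structure OrientedGraph (V : Type*) where
  mate : V × ZMod 3 → V × ZMod 3
  mate_mate : ∀ d, mate (mate d) = d

namespace OrientedGraph

variable {V : Type*} (G : OrientedGraph V)

/-- The slot `d` is filled by a half-edge. -/
def IsHalfEdge (d : V × ZMod 3) : Prop := G.mate d ≠ d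

/-- The graph is trivalent, hence (with the cyclic order of the slots) a cubic ribbon graph. -/
def IsTrivalent : Prop := ∀ d, G.IsHalfEdge d

/-- `G'` arises from `G` by adding edges only: it has the same vertices, and every edge of `G` is
an edge of `G'` that occupies the same slots, so that all turns along edges of `G` are kept. -/
def IsCompletedBy (G' : OrientedGraph V) : Prop :=
  ∀ d, G.IsHalfEdge d → G'.mate d = G.mate d

/-- The pairs of consecutive entries of a list that is read cyclically. -/
def cyclicPairs {α : Type*} (l : List α) : List (α × α) := l.zip (l.rotate 1)

/-- A closed path, given by the list of the half-edges through which it leaves the successive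
vertices: the edge `{d, mate d}` is traversed from the vertex of `d` to the vertex of `mate d`, and
the next half-edge starts there. The empty list is the constant path. -/
def IsClosedPath (γ : List (V × ZMod 3)) : Prop :=
  (∀ d ∈ γ, G.IsHalfEdge d) ∧ ∀ p ∈ cyclicPairs γ, p.2.1 = (G.mate p.1).1

/-- A cycle: a closed path that never goes back along the edge through which it has just come, so
that it makes a left or a right turn at every vertex. -/
def IsCycle (γ : List (V × ZMod 3)) : Prop :=
  γ ≠ [] ∧ G.IsClosedPath γ ∧ ∀ p ∈ cyclicPairs γ, p.2 ≠ G.mate p.1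

/-- A circuit: a cycle that meets every vertex at most once. (As a cycle does not backtrack, it then
also meets every edge at most once.) -/
def IsCircuit (γ : List (V × ZMod 3)) : Prop :=
  G.IsCycle γ ∧ (γ.map Prod.fst).Nodup

/-- Every connected component is a circuit: through every vertex there is a circuit such that the
vertices of the circuit carry no other edges than those of the circuit. -/
def ComponentsAreCircuits : Prop :=
  ∀ v : V, ∃ γ, G.IsCircuit γ ∧ v ∈ γ.map Prod.fst ∧
    ∀ d, G.IsHalfEdge d → d.1 ∈ γ.map Prod.fst → d ∈ γ ∨ G.mate d ∈ γ

/-- The turn of a path that runs through the edge of `d` and then leaves through the half-edge `e`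
at the vertex of `mate d`. The slots being in counterclockwise order, the half-edge to the left of
somebody who arrives through slot `i` is the one in slot `i - 1`, and the half-edge to the right is
the one in slot `i + 1`. -/
def turn (d e : V × ZMod 3) : Turn :=
  if e.2 = (G.mate d).2 - 1 then Turn.left else Turn.right

/-- The word in `L` and `R` that a cycle carries. -/
def word (γ : List (V × ZMod 3)) : List Turn :=
  (cyclicPairs γ).map fun p => G.turn p.1 p.2

/-- Elementary moves between closed paths: change of the starting point, and cancellation of an edge
that is traversed and immediately traversed back. -/
inductive HomotopyMove : List (V × ZMod 3) → List (V × ZMod 3) → Prop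
  | rotate (γ : List (V × ZMod 3)) (n : ℕ) : HomotopyMove γ (γ.rotate n)
  | cancel (d : V × ZMod 3) (γ : List (V × ZMod 3))
      (h : G.IsClosedPath (d :: G.mate d :: γ)) : HomotopyMove (d :: G.mate d :: γ) γ

/-- Free homotopy of closed paths in the graph. As the punctured surface of a ribbon graph retracts
onto the graph, this is the same as free homotopy in the surface. -/
def FreelyHomotopic : List (V × ZMod 3) → List (V × ZMod 3) → Prop :=
  Relation.EqvGen G.HomotopyMove

/-- The closed path is homotopically essential, that is, not null-homotopic. -/
def IsEssential (γ : List (V × ZMod 3)) : Prop := ¬ G.FreelyHomotopic γ []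

/-- The closed path is peripheral: it is freely homotopic to a path around a cusp, in one of the two
directions and any number of times, that is, to a cycle which consists of left turns only or
(the same in the opposite direction) of right turns only. -/
def IsPeripheral (γ : List (V × ZMod 3)) : Prop :=
  ∃ δ, G.IsCycle δ ∧ ((∀ t ∈ G.word δ, t = Turn.left) ∨ ∀ t ∈ G.word δ, t = Turn.right) ∧
    G.FreelyHomotopic γ δ

/-- A cusp, given by the cycle which runs once around it: a cycle of left turns only, without
repetitions. The corners of the triangles around the cusp correspond to the entries of `γ`. -/
def IsCusp (γ : List (V × ZMod 3)) : Prop :=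
  G.IsCycle γ ∧ (∀ t ∈ G.word γ, t = Turn.left) ∧ γ.Nodup

/-- The girth: the length of a shortest circuit (`⊤` if there is none). -/
noncomputable def girth : ℕ∞ := ⨅ γ ∈ {γ | G.IsCircuit γ}, (γ.length : ℕ∞)

end OrientedGraph

/-! Measure a word by its cost: its length if only one letter occurs, its trace otherwise. Cost is
invariant under rotation and reversal and grows by at least one with every inserted letter
(`cost_mono`). As `L` and `R` generate a free semigroup, at most `N(m) + 2m + 1` words have cost at
most `m` (`finite_ncard_cost_le`).

It suffices to find a trivalent completion all of whose cycles have cost at least `k`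
(`CyclesCost`). A cycle turning in one direction only is peripheral and has length at least `k`; any
other has trace at least `k`. The girth bound follows because a word of length `l` has trace at most
`φ ^ l + 1` (`wordTrace_le`).

The given graph has this property and exactly one empty slot per vertex. Joining two empty slots
preserves it if all paths between them have cost at least `k` (`IsLink.cyclesCost`). The delicate
new cycles make a loop at either end of the new edge; `cost_two_loops` handles them.

By parity empty slots come in pairs `a₁`, `a₂`. With `m = k - 2`, the size of `V` yields a vertex
`x` beyond cost `m` from both, whose partner `y` is beyond it from at least one, say `a₂`. If the
slot at `x` is empty, join it to `a₁`; otherwise replace the edge `xy` by `a₁x` and `a₂y`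
(`CyclesCost.switch`). Either way fewer slots remain empty, so induction finishes. -/

namespace Turn

/-! ### Words in `L` and `R` and their matrices. -/

/-- The opposite turn. -/
def opp : Turn → Turn
  | left => right
  | right => left

@[simp] theorem opp_opp (t : Turn) : t.opp.opp = t := by cases t <;> rfl

@[simp] theorem opp_left : left.opp = right := rfl

@[simp] theorem opp_right : right.opp = left := rfl

theorem eq_or_eq_opp (s t : Turn) : s = t ∨ s = t.opp := by
  cases s <;> cases t <;> simp [opp]

/-- The product of the matrices of the letters of a word. -/
def wordMat (w : List Turn) : Matrix (Fin 2) (Fin 2) ℤ := (w.map mat).prod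

theorem wordTrace_eq (w : List Turn) : wordTrace w = wordMat w 0 0 + wordMat w 1 1 := by
  simp [wordTrace, wordMat, Matrix.trace_fin_two]

@[simp] theorem wordMat_nil : wordMat [] = 1 := rfl

@[simp] theorem wordMat_cons (t : Turn) (w : List Turn) :
    wordMat (t :: w) = mat t * wordMat w := by simp [wordMat]

theorem wordMat_append (v w : List Turn) : wordMat (v ++ w) = wordMat v * wordMat w := by
  simp [wordMat]

theorem det_wordMat (w : List Turn) : (wordMat w).det = 1 := by
  induction w with
  | nil => simp
  | cons t w ih => rw [wordMat_cons, Matrix.det_mul, ih]; cases t <;> simp [mat, Matrix.det_fin_two]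

theorem wordMat_det (w : List Turn) :
    wordMat w 0 0 * wordMat w 1 1 - wordMat w 0 1 * wordMat w 1 0 = 1 := by
  rw [← Matrix.det_fin_two, det_wordMat]

theorem wordMat_left_cons (w : List Turn) :
    wordMat (left :: w) = !![wordMat w 0 0 + wordMat w 1 0, wordMat w 0 1 + wordMat w 1 1;
      wordMat w 1 0, wordMat w 1 1] := by
  ext i j
  fin_cases i <;> fin_cases j <;> simp [mat, Matrix.mul_apply, Fin.sum_univ_two]

theorem wordMat_right_cons (w : List Turn) :
    wordMat (right :: w) = !![wordMat w 0 0, wordMat w 0 1;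
      wordMat w 0 0 + wordMat w 1 0, wordMat w 0 1 + wordMat w 1 1] := by
  ext i j
  fin_cases i <;> fin_cases j <;> simp [mat, Matrix.mul_apply, Fin.sum_univ_two]

theorem wordMat_entries (w : List Turn) :
    1 ≤ wordMat w 0 0 ∧ 0 ≤ wordMat w 0 1 ∧ 0 ≤ wordMat w 1 0 ∧ 1 ≤ wordMat w 1 1 := by
  induction w with
  | nil => simp
  | cons t w ih =>
    obtain ⟨h1, h2, h3, h4⟩ := ih
    cases t
    · rw [wordMat_left_cons]; simp; omega
    · rw [wordMat_right_cons]; simp; omega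

/-- All letters of the word are `t`. -/
def Pure (t : Turn) (w : List Turn) : Prop := ∀ s ∈ w, s = t

theorem pure_iff (t : Turn) (w : List Turn) : Pure t w ↔ w = List.replicate w.length t :=
  List.eq_replicate_length.symm

theorem wordMat_replicate_left (n : ℕ) : wordMat (List.replicate n left) = !![1, (n : ℤ); 0, 1] := by
  induction n with
  | zero => simp [Matrix.one_fin_two]
  | succ n ih => rw [List.replicate_succ, wordMat_left_cons, ih]; simp

theorem wordMat_replicate_right (n : ℕ) :
    wordMat (List.replicate n right) = !![1, 0; (n : ℤ), 1] := by
  induction n with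
  | zero => simp [Matrix.one_fin_two]
  | succ n ih => rw [List.replicate_succ, wordMat_right_cons, ih]; simp; ring

theorem wordMat_of_pure_left {w : List Turn} (h : Pure left w) :
    wordMat w = !![1, (w.length : ℤ); 0, 1] := by
  rw [(pure_iff _ _).1 h, wordMat_replicate_left]; simp

theorem wordMat_of_pure_right {w : List Turn} (h : Pure right w) :
    wordMat w = !![1, 0; (w.length : ℤ), 1] := by
  rw [(pure_iff _ _).1 h, wordMat_replicate_right]; simp

theorem Pure.cons {t : Turn} {w : List Turn} (h : Pure t w) : Pure t (t :: w) := by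
  simpa [Pure] using h

theorem one_le_of_not_pure_left {w : List Turn} (h : ¬ Pure left w) : 1 ≤ wordMat w 1 0 := by
  induction w with
  | nil => simp [Pure] at h
  | cons t w ih =>
    have he := wordMat_entries w
    cases t
    · rw [wordMat_left_cons]; simpa using ih fun h' => h h'.cons
    · rw [wordMat_right_cons]; simp; omega

theorem one_le_of_not_pure_right {w : List Turn} (h : ¬ Pure right w) : 1 ≤ wordMat w 0 1 := by
  induction w with
  | nil => simp [Pure] at h
  | cons t w ih =>
    have he := wordMat_entries w
    cases t
    · rw [wordMat_left_cons]; simp; omega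
    · rw [wordMat_right_cons]; simpa using ih fun h' => h h'.cons

/-! ### The cost of a word. -/

open Classical in
/-- The length of a word in one letter, and the trace of any other word. -/
noncomputable def cost (w : List Turn) : ℤ :=
  if Pure left w ∨ Pure right w then w.length else wordTrace w

theorem cost_pure {t : Turn} {w : List Turn} (h : Pure t w) : cost w = w.length := by
  cases t <;> simp [cost, h]

theorem cost_mixed {w : List Turn} (hl : ¬ Pure left w) (hr : ¬ Pure right w) :
    cost w = wordMat w 0 0 + wordMat w 1 1 := by
  simp [cost, hl, hr, wordTrace_eq]

theorem wordTrace_append_comm (v w : List Turn) : wordTrace (v ++ w) = wordTrace (w ++ v) := by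
  simp only [wordTrace, List.map_append, List.prod_append]
  exact Matrix.trace_mul_comm _ _

theorem cost_append_comm (v w : List Turn) : cost (v ++ w) = cost (w ++ v) := by
  have h (t : Turn) : Pure t (v ++ w) ↔ Pure t (w ++ v) := by simp [Pure, or_comm]
  classical exact if_congr (or_congr (h _) (h _)) (by simp [add_comm]) (wordTrace_append_comm v w)

theorem cost_rotate (w : List Turn) (n : ℕ) : cost (w.rotate n) = cost w := by
  rw [← List.rotate_mod]
  rcases w.eq_nil_or_concat with rfl | ⟨_, _, rfl⟩
  · simp
  · rw [List.rotate_eq_drop_append_take (Nat.mod_lt _ (by simp)).le, cost_append_comm,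
      List.take_append_drop]

/-- The word read backwards, with the turns seen from the other direction. -/
def rev (w : List Turn) : List Turn := (w.map opp).reverse

theorem mat_opp (t : Turn) : mat t.opp = (mat t).transpose := by
  cases t <;> ext i j <;> fin_cases i <;> fin_cases j <;> simp [mat, opp]

theorem wordMat_rev (w : List Turn) : wordMat (rev w) = (wordMat w).transpose := by
  induction w with
  | nil => simp [rev]
  | cons t w ih =>
    have : rev (t :: w) = rev w ++ [t.opp] := by simp [rev]
    rw [this, wordMat_append, ih, wordMat_cons t w, Matrix.transpose_mul, wordMat_cons,
      wordMat_nil, mul_one, mat_opp]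

theorem cost_rev (w : List Turn) : cost (rev w) = cost w := by
  have h (t : Turn) : Pure t (rev w) ↔ Pure t.opp w := by
    simp only [Pure, rev, List.mem_reverse, List.mem_map, forall_exists_index, and_imp,
      forall_apply_eq_imp_iff₂]
    refine forall₂_congr fun s _ => ?_
    cases s <;> cases t <;> simp
  have hl : (rev w).length = w.length := by simp [rev]
  classical refine if_congr ((or_congr (h _) (h _)).trans or_comm) (by rw [hl]) ?_
  simp [wordTrace_eq, wordMat_rev]

/-- For a mixed word, prepending a letter adds an off-diagonal entry to the trace, and this entry is
at least 1. Passing from `R ^ n` to `L R ^ n` turns the cost `n` into `n + 2`. -/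
theorem cost_cons (t : Turn) (w : List Turn) : cost w + 1 ≤ cost (t :: w) := by
  have he := wordMat_entries w
  by_cases h : Pure t w
  · rw [cost_pure h, cost_pure h.cons]; simp
  · have h1 : ¬ Pure t (t :: w) := fun h' => h fun s hs => h' s (List.mem_cons_of_mem _ hs)
    have h2 : ¬ Pure t.opp (t :: w) := fun h' => by
      have := h' t List.mem_cons_self
      cases t <;> simp at this
    cases t
    · rw [cost_mixed h1 h2, wordMat_left_cons]
      have hc := one_le_of_not_pure_left h
      by_cases hr : Pure right w
      · rw [cost_pure hr, wordMat_of_pure_right hr]; simp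
      · rw [cost_mixed h hr]; simp; omega
    · rw [cost_mixed h2 h1, wordMat_right_cons]
      have hc := one_le_of_not_pure_right h
      by_cases hl : Pure left w
      · rw [cost_pure hl, wordMat_of_pure_left hl]; simp
      · rw [cost_mixed hl h]; simp; omega

theorem cost_concat (w : List Turn) (t : Turn) : cost w + 1 ≤ cost (w ++ [t]) := by
  rw [cost_append_comm]; exact cost_cons t w

/-- Inserting a letter anywhere is prepending it, up to rotation. The prefix `p` makes the induction
go through. -/
theorem cost_mono {v w : List Turn} (h : v.Sublist w) : cost v ≤ cost w := by
  suffices ∀ p : List Turn, cost (p ++ v) ≤ cost (p ++ w) from this []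
  induction h with
  | slnil => simp
  | @cons _ l a _ ih =>
    intro p
    have := cost_cons a (l ++ p)
    rw [← List.cons_append, cost_append_comm, cost_append_comm _ p] at this
    linarith [ih p]
  | cons_cons a _ ih =>
    intro p
    simpa using ih (p ++ [a])

/-- If the words `t.opp u` and `t'.opp u'` have cost at least `k`, then so has the word that runs
through the two loops `t u t` and `t' u' t'`. -/
theorem cost_two_loops {k : ℤ} (t t' : Turn) (u u' : List Turn) (h : k ≤ cost (t.opp :: u))
    (h' : k ≤ cost (t'.opp :: u')) : k ≤ cost ((t :: u ++ [t]) ++ (t' :: u' ++ [t'])) := by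
  have same (t : Turn) (u u' : List Turn) (h : k ≤ cost (t.opp :: u))
      (h' : k ≤ cost (t.opp :: u')) : t = left →
      k ≤ cost ((t :: u ++ [t]) ++ (t :: u' ++ [t])) := by
    rintro rfl
    have key (u u' : List Turn) (h : k ≤ cost (right :: u)) (hu : ¬ Pure left u') :
        k ≤ cost ((left :: u ++ [left]) ++ (left :: u' ++ [left])) := by
      obtain ⟨a1, b1, c1, d1⟩ := wordMat_entries u
      obtain ⟨a2, b2, c2, d2⟩ := wordMat_entries u'
      have c3 := one_le_of_not_pure_left hu
      have e : cost ((left :: u ++ [left]) ++ (left :: u' ++ [left])) =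
          cost (left :: left :: (u ++ (left :: left :: u'))) := by
        rw [← List.append_assoc, cost_append_comm]; simp
      rw [e, cost_mixed (fun p => hu fun s hs => p s (by simp [hs]))
        (fun p => by simpa using p left (by simp))]
      simp only [wordMat_cons, wordMat_append, mat, Matrix.mul_apply, Fin.sum_univ_two]
      simp only [Matrix.of_apply, Matrix.cons_val', Matrix.cons_val_zero, Matrix.cons_val_one,
        Matrix.cons_val_fin_one, one_mul, zero_mul, zero_add]
      by_cases hr : Pure right u
      · rw [cost_pure hr.cons] at h
        rw [wordMat_of_pure_right hr]
        simp at h ⊢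
        nlinarith [Int.natCast_nonneg u.length]
      · rw [cost_mixed (fun p => by simpa using p right (by simp))
          (fun p => hr fun s hs => p s (by simp [hs])), wordMat_right_cons] at h
        simp at h
        nlinarith [mul_nonneg b1 c2, mul_nonneg c1 b2, mul_nonneg c1 c2]
    by_cases hu : Pure left u'
    -- If both loops turn left only, the whole word is a power of `L` of length `|u| + |u'| + 4`,
    -- whereas `R L ^ n` costs at most `n + 2`.
    · by_cases hv : Pure left u
      · have hp : Pure left ((left :: u ++ [left]) ++ (left :: u' ++ [left])) := by
          intro s hs
          simp at hs
          have := hu s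
          have := hv s
          tauto
        rw [cost_pure hp]
        have hb : cost (right :: u) ≤ u.length + 2 := by
          by_cases hz : Pure right u
          · rw [cost_pure hz.cons]; simp
          · rw [cost_mixed (fun p => by simpa using p right (by simp))
              (fun p => hz fun s hs => p s (by simp [hs])), wordMat_right_cons,
              wordMat_of_pure_left hv]
            simp; omega
        have := h.trans hb
        simp; omega
      · rw [cost_append_comm]; exact key u' u h' hv
    · exact key u u' h hu
  have bound (u : List Turn) :
      cost (right :: u) ≤ wordMat u 0 0 + wordMat u 0 1 + wordMat u 1 0 + wordMat u 1 1 := by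
    obtain ⟨a1, b1, c1, d1⟩ := wordMat_entries u
    by_cases hr : Pure right u
    · rw [cost_pure hr.cons, wordMat_of_pure_right hr]; simp
    · rw [cost_mixed (fun p => by simpa using p right (by simp))
        (fun p => hr fun s hs => p s (by simp [hs])), wordMat_right_cons]
      simp; omega
  have diff (u u' : List Turn) (h : k ≤ cost (right :: u)) :
      k ≤ cost ((left :: u ++ [left]) ++ (right :: u' ++ [right])) := by
    obtain ⟨a1, b1, c1, d1⟩ := wordMat_entries u
    obtain ⟨a2, b2, c2, d2⟩ := wordMat_entries u'
    refine (h.trans (bound u)).trans ?_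
    rw [cost_mixed (fun p => by simpa using p right (by simp))
        (fun p => by simpa using p left (by simp))]
    simp only [wordMat_cons, wordMat_append, mat, Matrix.mul_apply, Fin.sum_univ_two, wordMat_nil]
    simp
    nlinarith [mul_nonneg b1 c2, mul_nonneg c1 b2, mul_nonneg c1 c2, mul_nonneg b1 b2]
  have rev_cyc (t : Turn) (u : List Turn) : cost (t.opp :: rev u) = cost (t :: u) := by
    rw [← cost_rev (t :: u)]
    have : rev (t :: u) = rev u ++ [t.opp] := by simp [rev]
    rw [this, cost_append_comm]; rfl
  cases t <;> cases t'
  · exact same left u u' h h' rfl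
  · exact diff u u' h
  · rw [cost_append_comm]; exact diff u' u h'
  -- Reading backwards exchanges left and right, which reduces this case to two left loops.
  · rw [← cost_rev]
    have e : rev ((right :: u ++ [right]) ++ (right :: u' ++ [right])) =
        (left :: rev u' ++ [left]) ++ (left :: rev u ++ [left]) := by simp [rev]
    rw [e]
    refine same left _ _ ?_ ?_ rfl
    · exact h'.trans (rev_cyc left u').ge
    · exact h.trans (rev_cyc left u).ge

/-! ### Freeness of the semigroup and counting of words. -/

/-- The first letter can be read off the matrix: after `L` the upper row dominates the lower one,
after `R` the reverse. -/
theorem wordMat_injective : Function.Injective wordMat := by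
  intro v
  induction v with
  | nil =>
    intro w h
    cases w with
    | nil => rfl
    | cons t w =>
      exfalso
      have he := wordMat_entries w
      have h1 := congrFun (congrFun h 0) 1
      have h2 := congrFun (congrFun h 1) 0
      cases t
      · rw [wordMat_left_cons] at h1; simp at h1; omega
      · rw [wordMat_right_cons] at h2; simp at h2; omega
  | cons s v ih =>
    intro w h
    cases w with
    | nil =>
      exfalso
      have he := wordMat_entries v
      have h1 := congrFun (congrFun h 0) 1
      have h2 := congrFun (congrFun h 1) 0
      cases s
      · rw [wordMat_left_cons] at h1; simp at h1; omega
      · rw [wordMat_right_cons] at h2; simp at h2; omega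
    | cons t w =>
      have he := wordMat_entries w
      have he' := wordMat_entries v
      have hij (i j : Fin 2) := congrFun (congrFun h i) j
      have h00 := hij 0 0
      have h01 := hij 0 1
      have h10 := hij 1 0
      have h11 := hij 1 1
      have main : s = t ∧ wordMat v = wordMat w := by
        cases s <;> cases t <;>
          simp only [wordMat_left_cons, wordMat_right_cons, Matrix.of_apply, Matrix.cons_val',
            Matrix.cons_val_zero, Matrix.cons_val_one, Matrix.cons_val_fin_one] at h00 h01 h10 h11
        · refine ⟨rfl, ?_⟩
          ext i j
          fin_cases i <;> fin_cases j <;> simp <;> omega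
        · omega
        · omega
        · refine ⟨rfl, ?_⟩
          ext i j
          fin_cases i <;> fin_cases j <;> simp <;> omega
      rw [main.1, ih main.2]

/-- The diagonal is bounded by the trace. A zero off the diagonal would force `ad = 1` and trace 2,
so `b, c ≥ 1`, and `bc = ad - 1` bounds both. -/
theorem finite_trace_eq (m : ℕ) (hm : 3 ≤ m) :
    {A : Matrix (Fin 2) (Fin 2) ℤ |
      A ∈ Subsemigroup.closure {mat left, mat right} ∧ A.trace = m}.Finite := by
  have hpos (A : Matrix (Fin 2) (Fin 2) ℤ) (hA : A ∈ Subsemigroup.closure {mat left, mat right}) :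
      ∃ w, wordMat w = A := by
    induction hA using Subsemigroup.closure_induction with
    | mem x hx =>
      rcases hx with rfl | rfl
      · exact ⟨[left], by simp⟩
      · exact ⟨[right], by simp⟩
    | mul x y _ _ hx hy =>
      obtain ⟨v, rfl⟩ := hx
      obtain ⟨w, rfl⟩ := hy
      exact ⟨v ++ w, wordMat_append v w⟩
  have hfin : {A : Fin 2 → Fin 2 → ℤ | ∀ i, A i ∈ {r : Fin 2 → ℤ | ∀ j,
      r j ∈ Set.Icc (0 : ℤ) (m * m)}}.Finite :=
    Set.Finite.pi' fun _ => Set.Finite.pi' fun _ => Set.finite_Icc _ _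
  refine hfin.subset ?_
  rintro A ⟨hA, htr⟩
  obtain ⟨w, rfl⟩ := hpos A hA
  obtain ⟨a, b, c, d⟩ := wordMat_entries w
  have hdet := wordMat_det w
  rw [Matrix.trace_fin_two] at htr
  have hm' : (3 : ℤ) ≤ m := by exact_mod_cast hm
  set A := wordMat w
  have hb : A 0 1 ≠ 0 := by
    intro hb
    rw [hb] at hdet
    nlinarith
  have hc : A 1 0 ≠ 0 := by
    intro hc
    rw [hc] at hdet
    nlinarith
  have hb' : 1 ≤ A 0 1 := by omega
  have hc' : 1 ≤ A 1 0 := by omega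
  intro i j
  fin_cases i <;> fin_cases j <;> simp <;> constructor <;> nlinarith

theorem mem_closure_of_ne_nil {w : List Turn} (hw : w ≠ []) :
    wordMat w ∈ Subsemigroup.closure {mat left, mat right} := by
  have hmat (t : Turn) : mat t ∈ Subsemigroup.closure {mat left, mat right} :=
    Subsemigroup.subset_closure (by cases t <;> simp)
  induction w with
  | nil => exact absurd rfl hw
  | cons t w ih =>
    rw [wordMat_cons]
    rcases eq_or_ne w [] with rfl | h
    · simpa using hmat t
    · exact mul_mem (hmat t) (ih h)

theorem finite_ncard_cost_le (m : ℕ) : {w : List Turn | cost w ≤ m}.Finite ∧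
    {w : List Turn | cost w ≤ m}.ncard ≤ traceCountSum m + 2 * m + 1 := by
  classical
  let P (t : Turn) : Finset (List Turn) :=
    (Finset.range (m + 1)).image fun j => List.replicate j t
  -- The empty word is already counted among the powers of `L`, so the one-letter words number `(m +
  -- 1) + m`.
  let P' : Finset (List Turn) := (Finset.range m).image fun j => List.replicate (j + 1) right
  let Q (j : ℕ) : Set (Matrix (Fin 2) (Fin 2) ℤ) :=
    {A | A ∈ Subsemigroup.closure {mat left, mat right} ∧ A.trace = j}
  have hQ (j : ℕ) (hj : j ∈ Finset.Icc 3 m) : (Q j).Finite :=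
    finite_trace_eq j (Finset.mem_Icc.1 hj).1
  let M : Finset (Matrix (Fin 2) (Fin 2) ℤ) :=
    (Finset.Icc 3 m).attach.biUnion fun j => (hQ j.1 j.2).toFinset
  let F : Set (List Turn) := wordMat ⁻¹' (M : Set _)
  have hF : F.Finite := M.finite_toSet.preimage wordMat_injective.injOn
  have hFc : F.ncard ≤ traceCountSum m := by
    calc F.ncard ≤ (M : Set (Matrix (Fin 2) (Fin 2) ℤ)).ncard :=
          Set.ncard_le_ncard_of_injOn wordMat (fun _ h => h) wordMat_injective.injOn M.finite_toSet
      _ = M.card := Set.ncard_coe_finset M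
      _ ≤ ∑ j ∈ (Finset.Icc 3 m).attach, (hQ j.1 j.2).toFinset.card := Finset.card_biUnion_le
      _ = ∑ j ∈ (Finset.Icc 3 m).attach, traceCount j.1 := by
          refine Finset.sum_congr rfl fun j _ => ?_
          exact (Set.ncard_eq_toFinset_card _ _).symm
      _ = traceCountSum m := Finset.sum_attach (Finset.Icc 3 m) traceCount
  have hsub : {w : List Turn | cost w ≤ m} ⊆ ((P left ∪ P' : Finset _) : Set (List Turn)) ∪ F := by
    intro w hw
    have hw : cost w ≤ m := hw
    by_cases hl : Pure left w
    · left
      rw [cost_pure hl] at hw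
      have : w ∈ P left :=
        Finset.mem_image.2 ⟨w.length, by simp; omega, ((pure_iff _ _).1 hl).symm⟩
      simp [this]
    by_cases hr : Pure right w
    · left
      rw [cost_pure hr] at hw
      have hne : w.length ≠ 0 := fun h => hl (by simp [List.length_eq_zero_iff.1 h, Pure])
      have : w ∈ P' := Finset.mem_image.2 ⟨w.length - 1, by simp; omega, by
        rw [Nat.sub_add_cancel (by omega)]; exact ((pure_iff _ _).1 hr).symm⟩
      simp [this]
    right
    rw [cost_mixed hl hr] at hw
    have hne : w ≠ [] := by rintro rfl; exact hl (by simp [Pure])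
    have hb := one_le_of_not_pure_right hr
    have hc := one_le_of_not_pure_left hl
    obtain ⟨a, -, -, d⟩ := wordMat_entries w
    have hdet := wordMat_det w
    have h3 : 3 ≤ wordMat w 0 0 + wordMat w 1 1 := by
      by_contra h
      have h1 : wordMat w 0 0 = 1 := by omega
      have h2 : wordMat w 1 1 = 1 := by omega
      rw [h1, h2] at hdet
      nlinarith
    have hj : (wordMat w 0 0 + wordMat w 1 1).toNat ∈ Finset.Icc 3 m := by
      rw [Finset.mem_Icc]; omega
    show wordMat w ∈ (M : Set _)
    simp only [M, Finset.coe_biUnion, Set.mem_iUnion]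
    refine ⟨⟨_, hj⟩, by simp, ?_⟩
    simp only [Set.Finite.coe_toFinset]
    refine ⟨mem_closure_of_ne_nil hne, ?_⟩
    rw [Matrix.trace_fin_two]; omega
  have hfin : (((P left ∪ P' : Finset _) : Set (List Turn)) ∪ F).Finite :=
    (Finset.finite_toSet _).union hF
  refine ⟨hfin.subset hsub, (Set.ncard_le_ncard hsub hfin).trans ?_⟩
  refine (Set.ncard_union_le _ _).trans ?_
  rw [Set.ncard_coe_finset]
  have h1 : (P left).card ≤ m + 1 := Finset.card_image_le.trans (by simp)
  have h2 : P'.card ≤ m := Finset.card_image_le.trans (by simp)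
  have h3 := Finset.card_union_le (P left) P'
  omega

/-! ### Growth of the trace with the length. -/

/-- A product of `l` matrices `L` and `R` has operator norm at most `φ ^ l`. -/
theorem sq_norm_wordMat_le (w : List Turn) (x y : ℝ) :
    (wordMat w 0 0 * x + wordMat w 0 1 * y) ^ 2 + (wordMat w 1 0 * x + wordMat w 1 1 * y) ^ 2 ≤
      (Real.goldenRatio ^ w.length) ^ 2 * (x ^ 2 + y ^ 2) := by
  induction w with
  | nil => simp
  | cons t w ih =>
    have hφ := Real.goldenRatio_sq
    have hpos := Real.goldenRatio_pos
    have step (p q : ℝ) : (p + q) ^ 2 + q ^ 2 ≤ Real.goldenRatio ^ 2 * (p ^ 2 + q ^ 2) := by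
      have : 0 ≤ Real.goldenRatio * (Real.goldenRatio * (p ^ 2 + q ^ 2) * Real.goldenRatio -
          ((p + q) ^ 2 + q ^ 2)) := by
        have e : Real.goldenRatio * (Real.goldenRatio * (p ^ 2 + q ^ 2) * Real.goldenRatio -
          ((p + q) ^ 2 + q ^ 2)) = (Real.goldenRatio * p - q) ^ 2 := by
          linear_combination (Real.goldenRatio * p ^ 2 + Real.goldenRatio * q ^ 2 + q ^ 2) * hφ
        rw [e]; positivity
      nlinarith [nonneg_of_mul_nonneg_right this hpos]
    have hmul := mul_le_mul_of_nonneg_left ih (sq_nonneg Real.goldenRatio)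
    rw [List.length_cons, pow_succ Real.goldenRatio, mul_pow _ Real.goldenRatio]
    cases t
    · rw [wordMat_left_cons]
      have := step (wordMat w 0 0 * x + wordMat w 0 1 * y) (wordMat w 1 0 * x + wordMat w 1 1 * y)
      simp only [Matrix.of_apply, Matrix.cons_val', Matrix.cons_val_zero, Matrix.cons_val_one,
        Matrix.cons_val_fin_one, Int.cast_add]
      linarith
    · rw [wordMat_right_cons]
      have := step (wordMat w 1 0 * x + wordMat w 1 1 * y) (wordMat w 0 0 * x + wordMat w 0 1 * y)
      simp only [Matrix.of_apply, Matrix.cons_val', Matrix.cons_val_zero, Matrix.cons_val_one,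
        Matrix.cons_val_fin_one, Int.cast_add]
      linarith

/-- If `A` has determinant 1 and norm at most `s`, then `det (s² - AᵀA) ≥ 0` bounds `s²` times the
sum of the squared entries by `s⁴ + 1`. Hence `s²(a + d)² ≤ (s² + 1)²`, so the trace is at most `s +
1/s`. -/
theorem wordTrace_le (w : List Turn) :
    (wordTrace w : ℝ) ≤ Real.goldenRatio ^ w.length + 1 := by
  have hq := sq_norm_wordMat_le w
  have hdet : (wordMat w 0 0 : ℝ) * wordMat w 1 1 - wordMat w 0 1 * wordMat w 1 0 = 1 := by
    exact_mod_cast wordMat_det w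
  have h1 : 1 ≤ Real.goldenRatio ^ w.length := one_le_pow₀ Real.one_lt_goldenRatio.le
  rw [wordTrace_eq]
  push_cast
  generalize (wordMat w 0 0 : ℝ) = a at *
  generalize (wordMat w 0 1 : ℝ) = b at *
  generalize (wordMat w 1 0 : ℝ) = c at *
  generalize (wordMat w 1 1 : ℝ) = d at *
  generalize Real.goldenRatio ^ w.length = s at *
  have hF : (a * b + c * d) ^ 2 ≤ (s ^ 2 - (a ^ 2 + c ^ 2)) * (s ^ 2 - (b ^ 2 + d ^ 2)) := by
    -- The norm bound at the vectors `(x, 1)` says that this quadratic polynomial in `x` is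
    -- nonnegative.
    have := discrim_le_zero (a := s ^ 2 - (a ^ 2 + c ^ 2)) (b := -2 * (a * b + c * d))
      (c := s ^ 2 - (b ^ 2 + d ^ 2)) fun x => by linarith [hq x 1]
    rw [discrim] at this
    linarith
  have hsq : (s * (a + d)) ^ 2 ≤ (s ^ 2 + 1) ^ 2 := by
    have e : (a * d - b * c) ^ 2 = 1 := by rw [hdet]; norm_num
    nlinarith [mul_nonneg (sq_nonneg s) (sq_nonneg (b - c))]
  have := abs_le_of_sq_le_sq' hsq (by positivity)
  nlinarith [this.2]

end Turn

/-! ### Paths between slots, described by their turns. -/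

namespace OrientedGraph

open Turn

variable {V : Type*}

/-- The slot through which one leaves a vertex that was entered through the slot `s`. -/
def exitSlot (s : V × ZMod 3) : Turn → V × ZMod 3
  | left => (s.1, s.2 - 1)
  | right => (s.1, s.2 + 1)

@[simp] theorem exitSlot_fst (s : V × ZMod 3) (t : Turn) : (exitSlot s t).1 = s.1 := by
  cases t <;> rfl

@[simp] theorem exitSlot_opp (s : V × ZMod 3) (t : Turn) : exitSlot (exitSlot s t) t.opp = s := by
  cases t <;> simp [exitSlot]

theorem exitSlot_exitSlot (s : V × ZMod 3) (t : Turn) :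
    exitSlot (exitSlot s t) t = exitSlot s t.opp := by
  obtain ⟨v, i⟩ := s
  cases t <;> simp [exitSlot] <;> revert i <;> decide

theorem exitSlot_ne (s : V × ZMod 3) (t : Turn) : exitSlot s t ≠ s := by
  obtain ⟨v, i⟩ := s
  cases t <;> simp [exitSlot]

theorem exitSlot_eq_iff {s e : V × ZMod 3} {t : Turn} :
    exitSlot s t = e ↔ s = exitSlot e t.opp := by
  constructor
  · rintro rfl; simp
  · rintro rfl
    have := exitSlot_opp e t.opp
    simpa using this

variable (G : OrientedGraph V)

theorem IsHalfEdge.mate {G : OrientedGraph V} {d : V × ZMod 3} (h : G.IsHalfEdge d) :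
    G.IsHalfEdge (G.mate d) := by
  rw [IsHalfEdge, G.mate_mate]; exact h.symm

/-- A path which enters a vertex through the slot `s`, makes the turns of the word and traverses
the edges behind them, and finally enters a vertex through the slot `z`. -/
def Arr : V × ZMod 3 → List Turn → V × ZMod 3 → Prop
  | s, [], z => s = z
  | s, t :: w, z => G.IsHalfEdge (exitSlot s t) ∧ Arr (G.mate (exitSlot s t)) w z

/-- A path which enters a vertex through the slot `s`, makes the turns of the word and traverses
the edges behind them except for the last one, so that it finally leaves through the slot `b`,
which may be empty. -/
def Exit : V × ZMod 3 → List Turn → V × ZMod 3 → Prop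
  | _, [], _ => False
  | s, t :: w, b => (w = [] ∧ exitSlot s t = b) ∨
      (G.IsHalfEdge (exitSlot s t) ∧ Exit (G.mate (exitSlot s t)) w b)

variable {G}

theorem Exit.ne_nil {s b : V × ZMod 3} {w : List Turn} (h : G.Exit s w b) : w ≠ [] := by
  rintro rfl; exact h

theorem Arr.append {s z y : V × ZMod 3} {v w : List Turn} (h : G.Arr s v z) (h' : G.Arr z w y) :
    G.Arr s (v ++ w) y := by
  induction v generalizing s with
  | nil => obtain rfl : s = z := h; exact h'
  | cons t v ih => exact ⟨h.1, ih h.2⟩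

theorem Arr.exit_append {s z b : V × ZMod 3} {v w : List Turn} (h : G.Arr s v z)
    (h' : G.Exit z w b) : G.Exit s (v ++ w) b := by
  induction v generalizing s with
  | nil => obtain rfl : s = z := h; exact h'
  | cons t v ih => exact Or.inr ⟨h.1, ih h.2⟩

theorem Exit.arr {s b : V × ZMod 3} {w : List Turn} (h : G.Exit s w b) (hb : G.IsHalfEdge b) :
    G.Arr s w (G.mate b) := by
  induction w generalizing s with
  | nil => exact h.elim
  | cons t w ih =>
    rcases h with ⟨rfl, rfl⟩ | ⟨h1, h2⟩
    · exact ⟨hb, rfl⟩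
    · exact ⟨h1, ih h2⟩

theorem Arr.exit {s z : V × ZMod 3} {w : List Turn} (h : G.Arr s w z) (hw : w ≠ []) :
    G.IsHalfEdge z ∧ G.Exit s w (G.mate z) := by
  induction w generalizing s with
  | nil => exact absurd rfl hw
  | cons t w ih =>
    obtain ⟨h1, h2⟩ := h
    by_cases hw : w = []
    · subst hw
      obtain rfl : _ = z := h2
      exact ⟨h1.mate, Or.inl ⟨rfl, by rw [G.mate_mate]⟩⟩
    · exact ⟨(ih h2 hw).1, Or.inr ⟨h1, (ih h2 hw).2⟩⟩

theorem Exit.concat {s b : V × ZMod 3} {w : List Turn} (h : G.Exit s w b) :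
    ∃ v t z, w = v ++ [t] ∧ G.Arr s v z ∧ exitSlot z t = b := by
  induction w generalizing s with
  | nil => exact h.elim
  | cons t w ih =>
    rcases h with ⟨rfl, rfl⟩ | ⟨h1, h2⟩
    · exact ⟨[], t, s, rfl, rfl, rfl⟩
    · obtain ⟨v, t', z, rfl, h3, h4⟩ := ih h2
      exact ⟨t :: v, t', z, rfl, ⟨h1, h3⟩, h4⟩

theorem Exit.rev {s b : V × ZMod 3} {w : List Turn} (h : G.Exit s w b) :
    G.Exit b (Turn.rev w) s := by
  induction w generalizing s with
  | nil => exact h.elim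
  | cons t w ih =>
    rcases h with ⟨rfl, rfl⟩ | ⟨h1, h2⟩
    · exact Or.inl ⟨rfl, exitSlot_opp s t⟩
    · have h3 := (ih h2).arr h1.mate
      rw [G.mate_mate] at h3
      have : Turn.rev (t :: w) = Turn.rev w ++ [t.opp] := by simp [Turn.rev]
      rw [this]
      exact h3.exit_append (Or.inl ⟨rfl, exitSlot_opp s t⟩)

theorem Arr.unique {s z z' : V × ZMod 3} {w : List Turn} (h : G.Arr s w z) (h' : G.Arr s w z') :
    z = z' := by
  induction w generalizing s with
  | nil => exact Eq.trans (Eq.symm h) h'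
  | cons t w ih => exact ih h.2 h'.2

/-- All cycles carry words of cost at least `k`. -/
def CyclesCost (k : ℤ) (G : OrientedGraph V) : Prop :=
  ∀ s w, w ≠ [] → G.Arr s w s → k ≤ cost w

/-- In a graph whose cycles have cost at least `k`, a path that comes back to the slot where it
started contains a loop `t u t` around a cycle with the word `t.opp u`. -/
theorem exists_loop {k : ℤ} (hG : CyclesCost k G) {a : V × ZMod 3} {w : List Turn}
    (h : G.Exit a w a) :
    ∃ t u, (t :: u ++ [t]).Sublist w ∧ k ≤ cost (t.opp :: u) := by
  induction hn : w.length using Nat.strong_induction_on generalizing a w with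
  | _ n ih =>
    obtain ⟨v, t', z, rfl, h1, h2⟩ := h.concat
    cases v with
    | nil =>
      obtain rfl : a = z := h1
      exact absurd h2 (exitSlot_ne _ _)
    | cons t v =>
      obtain ⟨he, h3⟩ := h1
      rw [exitSlot_eq_iff] at h2
      rcases t'.eq_or_eq_opp t with rfl | rfl
      -- Equal first and last turns: the path leaves and returns through the two slots other than
      -- `a`, and the turn `t.opp` between them closes the middle part to a cycle.
      · refine ⟨t', v, List.Sublist.refl _, hG z _ (by simp) ?_⟩
        have e : exitSlot z t'.opp = exitSlot a t' := by rw [h2, exitSlot_exitSlot, opp_opp]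
        exact ⟨e ▸ he, e ▸ h3⟩
      -- Opposite turns: the path comes back along its first edge. That edge is stripped at both
      -- ends.
      · rw [opp_opp] at h2
        subst h2
        have hv : v ≠ [] := by
          rintro rfl
          exact he h3
        obtain ⟨-, h4⟩ := h3.exit hv
        obtain ⟨s, u, h5, h6⟩ := ih v.length (by simp at hn; omega) h4 rfl
        exact ⟨s, u, h5.trans (by simp), h6⟩

/-! ### Adding and switching edges. -/

/-- `G'` arises from `G` by joining the empty slots `a` and `b` by an edge. -/
structure IsLink (G G' : OrientedGraph V) (a b : V × ZMod 3) : Prop where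
  left_empty : G.mate a = a
  right_empty : G.mate b = b
  ne : a ≠ b
  left : G'.mate a = b
  other : ∀ d, d ≠ a → d ≠ b → G'.mate d = G.mate d

section IsLink

variable {G' : OrientedGraph V} {a b : V × ZMod 3}

theorem IsLink.right (h : IsLink G G' a b) : G'.mate b = a := by rw [← h.left, G'.mate_mate]

theorem IsLink.symm (h : IsLink G G' a b) : IsLink G G' b a :=
  ⟨h.right_empty, h.left_empty, h.ne.symm, h.right, fun d h1 h2 => h.other d h2 h1⟩

theorem IsLink.mate_eq (h : IsLink G G' a b) {d : V × ZMod 3} (hd : G.IsHalfEdge d) :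
    G'.mate d = G.mate d :=
  h.other d (fun e => hd (e ▸ h.left_empty)) (fun e => hd (e ▸ h.right_empty))

theorem IsLink.isHalfEdge (h : IsLink G G' a b) {d : V × ZMod 3} (hd : G.IsHalfEdge d) :
    G'.IsHalfEdge d := by
  rw [IsHalfEdge, h.mate_eq hd]; exact hd

theorem IsLink.isHalfEdge_left (h : IsLink G G' a b) : G'.IsHalfEdge a := by
  rw [IsHalfEdge, h.left]; exact h.ne.symm

theorem IsLink.arr (h : IsLink G G' a b) {s z : V × ZMod 3} {w : List Turn} (hw : G.Arr s w z) :
    G'.Arr s w z := by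
  induction w generalizing s with
  | nil => exact hw
  | cons t w ih => exact ⟨h.isHalfEdge hw.1, h.mate_eq hw.1 ▸ ih hw.2⟩

theorem IsLink.exit (h : IsLink G G' a b) {s z : V × ZMod 3} {w : List Turn} (hw : G.Exit s w z) :
    G'.Exit s w z := by
  induction w generalizing s with
  | nil => exact hw
  | cons t w ih =>
    rcases hw with hw | hw
    · exact Or.inl hw
    · exact Or.inr ⟨h.isHalfEdge hw.1, h.mate_eq hw.1 ▸ ih hw.2⟩

theorem IsLink.cyclesCost_of (h : IsLink G G' a b) {k : ℤ} (hG : CyclesCost k G') :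
    CyclesCost k G :=
  fun s w hw hs => hG s w hw (h.arr hs)

theorem IsLink.half_cases (h : IsLink G G' a b) {d : V × ZMod 3} (hd : G'.IsHalfEdge d) :
    (G.IsHalfEdge d ∧ G'.mate d = G.mate d) ∨ d = a ∨ d = b := by
  by_cases h1 : d = a
  · exact Or.inr (Or.inl h1)
  by_cases h2 : d = b
  · exact Or.inr (Or.inr h2)
  have := h.other d h1 h2
  exact Or.inl ⟨by rwa [IsHalfEdge, ← this], this⟩

/-- A path in `G'` runs in `G`, or in `G` up to the first passage through the new edge. -/
theorem IsLink.arr_split (h : IsLink G G' a b) {s z : V × ZMod 3} {w : List Turn}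
    (hw : G'.Arr s w z) : G.Arr s w z ∨
      ∃ w₁ w₂ c, w = w₁ ++ w₂ ∧ (c = a ∨ c = b) ∧ G.Exit s w₁ c ∧ G'.Arr (G'.mate c) w₂ z := by
  induction w generalizing s with
  | nil => exact Or.inl hw
  | cons t w ih =>
    obtain ⟨h1, h2⟩ := hw
    rcases h.half_cases h1 with ⟨h3, h4⟩ | h3
    · rw [h4] at h2
      rcases ih h2 with h5 | ⟨w₁, w₂, c, rfl, hc, h6, h7⟩
      · exact Or.inl ⟨h3, h5⟩
      · exact Or.inr ⟨t :: w₁, w₂, c, rfl, hc, Or.inr ⟨h3, h6⟩, h7⟩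
    · exact Or.inr ⟨[t], w, _, rfl, h3, Or.inl ⟨rfl, rfl⟩, h2⟩

theorem IsLink.exit_split (h : IsLink G G' a b) {s z : V × ZMod 3} {w : List Turn}
    (hw : G'.Exit s w z) : G.Exit s w z ∨
      ∃ w₁ w₂ c, w = w₁ ++ w₂ ∧ (c = a ∨ c = b) ∧ G.Exit s w₁ c ∧ G'.Exit (G'.mate c) w₂ z := by
  obtain ⟨v, t, y, rfl, h1, h2⟩ := hw.concat
  rcases h.arr_split h1 with h3 | ⟨w₁, w₂, c, rfl, hc, h4, h5⟩
  · exact Or.inl (h3.exit_append (Or.inl ⟨rfl, h2⟩))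
  · exact Or.inr ⟨w₁, w₂ ++ [t], c, by simp, hc, h4, h5.exit_append (Or.inl ⟨rfl, h2⟩)⟩

theorem not_arr_of_empty {s z : V × ZMod 3} {w : List Turn} (hz : G.mate z = z) (hw : w ≠ []) :
    ¬ G.Arr s w z :=
  fun h => (h.exit hw).1 hz

/-- Joining two empty slots keeps all cycles at cost at least `k` if all paths between the slots
have cost at least `k`. -/
theorem IsLink.cyclesCost (h : IsLink G G' a b) {k : ℤ} (hG : CyclesCost k G)
    (hab : ∀ w, G.Exit a w b → k ≤ cost w) : CyclesCost k G' := by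
  have main (a b : V × ZMod 3) (h : IsLink G G' a b) (hab : ∀ w, G.Exit a w b → k ≤ cost w)
      (w : List Turn) (hw : w ≠ []) (hc : G'.Arr b w b) : k ≤ cost w := by
    have hba (w : List Turn) (hw : G.Exit b w a) : k ≤ cost w := by
      rw [← cost_rev]; exact hab _ hw.rev
    rcases h.arr_split hc with h1 | ⟨w₁, w₂, c, rfl, hc, h2, h3⟩
    · exact absurd h1 (not_arr_of_empty h.right_empty hw)
    rcases hc with rfl | rfl
    · exact (hba _ h2).trans (cost_mono (by simp))
    rw [h.right] at h3
    rcases h.arr_split h3 with h4 | ⟨w₃, w₄, e, rfl, he, h5, h6⟩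
    · have : w₂ ≠ [] := by
        rintro rfl
        exact h.ne h4
      exact absurd h4 (not_arr_of_empty h.right_empty this)
    rcases he with rfl | rfl
    -- The path returns to `b`, crosses the new edge and returns to `a`: each excursion contains a
    -- loop around an old cycle.
    · obtain ⟨t, u, h7, h8⟩ := exists_loop hG h2
      obtain ⟨t', u', h9, h10⟩ := exists_loop hG h5
      refine (cost_two_loops t t' u u' h8 h10).trans (cost_mono ?_)
      rw [← List.append_assoc w₁ w₃ w₄]
      exact (h7.append h9).trans (List.sublist_append_left _ _)
    · exact (hab _ h5).trans (cost_mono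
        ((List.sublist_append_left _ _).trans (List.sublist_append_right _ _)))
  intro s w hw hs
  rcases h.arr_split hs with h1 | ⟨w₁, w₂, c, rfl, hc, h2, h3⟩
  · exact hG s w hw h1
  -- Rotate the cycle so that it starts right after a passage through the new edge.
  rw [cost_append_comm]
  have h4 : G'.IsHalfEdge c := by
    rcases hc with rfl | rfl
    · exact h.isHalfEdge_left
    · exact h.symm.isHalfEdge_left
  have h5 := h3.append ((h.exit h2).arr h4)
  have h6 : w₂ ++ w₁ ≠ [] := by simp [h2.ne_nil]
  rcases hc with rfl | rfl
  · rw [h.left] at h5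
    exact main _ _ h hab _ h6 h5
  · rw [h.right] at h5
    exact main _ _ h.symm (fun w hw => by rw [← cost_rev]; exact hab _ hw.rev) _ h6 h5

/-- Removing an edge between `x` and `y` and joining its ends to the empty slots `a₁` and `a₂`. -/
theorem CyclesCost.switch {k : ℤ} {G G₀ G₁ G₂ : OrientedGraph V} {a₁ a₂ x y : V × ZMod 3}
    (hG : CyclesCost k G) (h₀ : IsLink G₀ G x y) (h₁ : IsLink G₀ G₁ a₁ x)
    (h₂ : IsLink G₁ G₂ a₂ y) (h1x : ∀ w, G.Exit a₁ w x → k ≤ cost w)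
    (h2x : ∀ w, G.Exit a₂ w x → k ≤ cost w) (h2y : ∀ w, G.Exit a₂ w y → k ≤ cost w)
    (h1y : ∀ w, G.Exit a₁ w y → k ≤ cost w + 1) : CyclesCost k G₂ := by
  have hxy (w : List Turn) (hw : G₀.Exit x w y) : k ≤ cost w := by
    have h := (h₀.exit hw).arr h₀.symm.isHalfEdge_left
    rw [h₀.right] at h
    exact hG x w hw.ne_nil h
  refine h₂.cyclesCost (h₁.cyclesCost (h₀.cyclesCost_of hG) fun w hw => h1x w (h₀.exit hw))
    fun w hw => ?_
  -- Consider what follows the last passage through the edge `a₁x`. Starting at `x` it closes up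
  -- with the removed edge to a cycle of `G`; starting at `a₁` only `k - 1` is guaranteed.
  have tail (w : List Turn) (s : V × ZMod 3) (hs : s = a₁ ∨ s = x) (hw : G₁.Exit s w y) :
      k ≤ cost w + 1 := by
    induction hn : w.length using Nat.strong_induction_on generalizing s w with
    | _ n ih =>
      rcases h₁.exit_split hw with h | ⟨w₁, w₂, c, rfl, hc, h, h'⟩
      · rcases hs with rfl | rfl
        · exact h1y w (h₀.exit h)
        · linarith [hxy w h]
      · have hlen : w₂.length < n := by
          have := List.length_pos_of_ne_nil h.ne_nil
          simp at hn; omega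
        have := ih _ hlen w₂ (G₁.mate c) (by
          rcases hc with rfl | rfl
          · exact Or.inr h₁.left
          · exact Or.inl h₁.right) h' rfl
        linarith [cost_mono (List.sublist_append_right w₁ w₂)]
  rcases h₁.exit_split hw with h | ⟨w₁, w₂, c, rfl, hc, h, h'⟩
  · exact h2y w (h₀.exit h)
  · rcases hc with rfl | rfl
    · rw [h₁.left] at h'
      have h3 := tail w₂ _ (Or.inr rfl) h'
      cases w₁ with
      | nil => exact h.elim
      | cons t w₁ =>
        -- The nonempty stretch from `a₂` to `a₁` supplies the missing unit.
        have := cost_cons t (w₁ ++ w₂)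
        have := cost_mono (List.sublist_append_right w₁ w₂)
        rw [List.cons_append]
        linarith
    · exact (h2x _ (h₀.exit h)).trans (cost_mono (by simp))

end IsLink

end OrientedGraph

/-! ### Cycles as periodic sequences, and components that are circuits. -/

namespace OrientedGraph

open Turn

variable {V : Type*} {G : OrientedGraph V}

/-- The `i`-th entry of a nonempty list that is read cyclically. -/
def cyclicGet {α : Type*} (l : List α) (hl : l ≠ []) (i : ℕ) : α :=
  l[i % l.length]'(Nat.mod_lt _ (List.length_pos_of_ne_nil hl))

theorem cyclicGet_congr {α : Type*} {l : List α} (hl : l ≠ []) {i j : ℕ}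
    (h : i % l.length = j % l.length) : cyclicGet l hl i = cyclicGet l hl j := by
  simp only [cyclicGet, h]

theorem mem_iff_cyclicGet {α : Type*} {l : List α} (hl : l ≠ []) {x : α} :
    x ∈ l ↔ ∃ i, cyclicGet l hl i = x := by
  constructor
  · intro h
    obtain ⟨i, hi, rfl⟩ := List.getElem_of_mem h
    exact ⟨i, by simp [cyclicGet, Nat.mod_eq_of_lt hi]⟩
  · rintro ⟨i, rfl⟩
    exact List.getElem_mem _

theorem cyclicPairs_eq {α : Type*} (l : List α) (hl : l ≠ []) :
    cyclicPairs l =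
      (List.range l.length).map fun i => (cyclicGet l hl i, cyclicGet l hl (i + 1)) := by
  refine List.ext_getElem (by simp [cyclicPairs]) fun i h1 h2 => ?_
  have hi : i < l.length := by simpa using h2
  simp [cyclicPairs, cyclicGet, List.getElem_rotate, Nat.mod_eq_of_lt hi]

theorem forall_mem_cyclicPairs {α : Type*} {l : List α} (hl : l ≠ []) {p : α × α → Prop}
    (h : ∀ x ∈ cyclicPairs l, p x) (i : ℕ) : p (cyclicGet l hl i, cyclicGet l hl (i + 1)) := by
  have hi := Nat.mod_lt i (List.length_pos_of_ne_nil hl)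
  have := h (cyclicGet l hl (i % l.length), cyclicGet l hl (i % l.length + 1)) (by
    rw [cyclicPairs_eq l hl]
    exact List.mem_map.2 ⟨i % l.length, by simpa using hi, rfl⟩)
  rwa [cyclicGet_congr hl (Nat.mod_mod i _),
    cyclicGet_congr hl (i := i % l.length + 1) (j := i + 1) (by simp)] at this

/-- The cyclic entries of a list of half-edges form a path without backtracking. -/
structure IsThread (G : OrientedGraph V) (c : ℕ → V × ZMod 3) : Prop where
  half : ∀ i, G.IsHalfEdge (c i)
  fst : ∀ i, (c (i + 1)).1 = (G.mate (c i)).1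
  ne : ∀ i, c (i + 1) ≠ G.mate (c i)

/-- The turns of a path, given by the sequence of its half-edges. -/
def threadWord (G : OrientedGraph V) (c : ℕ → V × ZMod 3) (i m : ℕ) : List Turn :=
  (List.range m).map fun j => G.turn (c (i + j)) (c (i + j + 1))

@[simp] theorem length_threadWord (c : ℕ → V × ZMod 3) (i m : ℕ) :
    (threadWord G c i m).length = m := by simp [threadWord]

theorem IsCycle.isThread {γ : List (V × ZMod 3)} (h : G.IsCycle γ) :
    IsThread G (cyclicGet γ h.1) where
  half i := h.2.1.1 _ ((mem_iff_cyclicGet h.1).2 ⟨i, rfl⟩)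
  fst i := forall_mem_cyclicPairs (p := fun p => p.2.1 = (G.mate p.1).1) h.1 h.2.1.2 i
  ne i := forall_mem_cyclicPairs (p := fun p => p.2 ≠ G.mate p.1) h.1 h.2.2 i

theorem IsCycle.word_eq {γ : List (V × ZMod 3)} (h : G.IsCycle γ) :
    G.word γ = threadWord G (cyclicGet γ h.1) 0 γ.length := by
  simp [word, cyclicPairs_eq γ h.1, threadWord, Function.comp_def]

theorem length_word (γ : List (V × ZMod 3)) : (G.word γ).length = γ.length := by
  simp [word, cyclicPairs]

theorem exitSlot_turn {d e : V × ZMod 3} (h1 : e.1 = (G.mate d).1) (h2 : e ≠ G.mate d) :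
    exitSlot (G.mate d) (G.turn d e) = e := by
  obtain ⟨v, i⟩ := e
  unfold turn
  generalize G.mate d = s at *
  obtain ⟨w, j⟩ := s
  obtain rfl : v = w := h1
  have h3 : i ≠ j := fun h => h2 (by rw [h])
  have h4 : ∀ i j : ZMod 3, i ≠ j → i ≠ j - 1 → j + 1 = i := by decide
  split_ifs with h
  · simp only at h
    simp [exitSlot, h]
  · simp [exitSlot, h4 i j h3 h]

theorem turn_exitSlot (d : V × ZMod 3) (t : Turn) :
    G.turn d (exitSlot (G.mate d) t) = t := by
  generalize hs : G.mate d = s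
  obtain ⟨w, j⟩ := s
  have : ∀ j : ZMod 3, j + 1 ≠ j - 1 := by decide
  cases t <;> simp [turn, exitSlot, hs, this]

theorem IsThread.arr {c : ℕ → V × ZMod 3} (h : IsThread G c) (i m : ℕ) :
    G.Arr (G.mate (c i)) (threadWord G c i m) (G.mate (c (i + m))) := by
  induction m with
  | zero => rfl
  | succ m ih =>
    rw [threadWord, List.range_succ, List.map_append]
    refine Arr.append ih ?_
    have := exitSlot_turn (h.fst (i + m)) (h.ne (i + m))
    refine ⟨?_, ?_⟩
    · rw [this]; exact h.half _
    · show G.mate _ = _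
      rw [this]; rfl

theorem IsCycle.arr {γ : List (V × ZMod 3)} (h : G.IsCycle γ) :
    ∃ s, G.word γ ≠ [] ∧ G.Arr s (G.word γ) s := by
  refine ⟨G.mate (cyclicGet γ h.1 0), ?_, ?_⟩
  · rw [← List.length_pos_iff_ne_nil, length_word, List.length_pos_iff_ne_nil]; exact h.1
  · have := h.isThread.arr 0 γ.length
    rwa [← h.word_eq, cyclicGet_congr (i := 0 + γ.length) (j := 0) h.1 (by simp)] at this

/-- A circuit whose vertices carry no other edges. -/
structure IsCircuitComponent (G : OrientedGraph V) (γ : List (V × ZMod 3)) : Prop where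
  circuit : G.IsCircuit γ
  closed : ∀ d, G.IsHalfEdge d → d.1 ∈ γ.map Prod.fst → d ∈ γ ∨ G.mate d ∈ γ

section IsCircuitComponent

variable {γ : List (V × ZMod 3)}

theorem IsCircuit.mod_eq (h : G.IsCircuit γ) {i j : ℕ}
    (hij : (cyclicGet γ h.1.1 i).1 = (cyclicGet γ h.1.1 j).1) : i % γ.length = j % γ.length := by
  have hn := List.length_pos_of_ne_nil h.1.1
  have := (List.nodup_iff_injective_get.1 h.2) (a₁ := ⟨i % γ.length, by simpa using Nat.mod_lt _ hn⟩)
    (a₂ := ⟨j % γ.length, by simpa using Nat.mod_lt _ hn⟩) (by simpa [cyclicGet] using hij)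
  simpa using this

theorem IsCircuitComponent.eq_or_eq (h : IsCircuitComponent G γ) (i : ℕ) {e : V × ZMod 3}
    (he : G.IsHalfEdge e) (hv : e.1 = (cyclicGet γ h.circuit.1.1 (i + 1)).1) :
    e = cyclicGet γ h.circuit.1.1 (i + 1) ∨ e = G.mate (cyclicGet γ h.circuit.1.1 i) := by
  have hγ := h.circuit.1.1
  rcases h.closed e he (by
    rw [hv]; exact List.mem_map_of_mem ((mem_iff_cyclicGet hγ).2 ⟨_, rfl⟩)) with h1 | h1
  · obtain ⟨j, rfl⟩ := (mem_iff_cyclicGet hγ).1 h1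
    exact Or.inl (cyclicGet_congr hγ (h.circuit.mod_eq hv))
  · obtain ⟨j, hj⟩ := (mem_iff_cyclicGet hγ).1 h1
    right
    have e1 : e = G.mate (cyclicGet γ hγ j) := by rw [hj, G.mate_mate]
    rw [e1, ← h.circuit.1.isThread.fst j] at hv
    have : j ≡ i [MOD γ.length] := Nat.ModEq.add_right_cancel' 1 (h.circuit.mod_eq hv)
    rw [e1, cyclicGet_congr hγ this]

theorem IsCircuitComponent.exists_empty_slot (h : IsCircuitComponent G γ) {v : V}
    (hv : v ∈ γ.map Prod.fst) : ∃ f, ∀ i, G.mate (v, i) = (v, i) ↔ i = f := by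
  have hγ := h.circuit.1.1
  have hT := h.circuit.1.isThread
  obtain ⟨d, hd, rfl⟩ := List.mem_map.1 hv
  obtain ⟨j, rfl⟩ := (mem_iff_cyclicGet hγ).1 hd
  obtain ⟨i, hi⟩ : ∃ i, cyclicGet γ hγ (i + 1) = cyclicGet γ hγ j := by
    have := List.length_pos_of_ne_nil hγ
    exact ⟨j + γ.length - 1, cyclicGet_congr hγ (by
      rw [Nat.sub_add_cancel (by omega)]; simp)⟩
  rw [← hi]
  have third : ∀ p q : ZMod 3, p ≠ q → ∃ f, ∀ i, (i ≠ p ∧ i ≠ q) ↔ i = f := by decide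
  have h1 := hT.half (i + 1)
  have h2 := (hT.half i).mate
  have h3 := hT.fst i
  have h4 := hT.ne i
  have h5 := fun e => h.eq_or_eq i (e := e)
  generalize cyclicGet γ hγ (i + 1) = p at *
  generalize G.mate (cyclicGet γ hγ i) = q at *
  obtain ⟨v, p⟩ := p
  obtain ⟨v', q⟩ := q
  obtain rfl : v = v' := h3
  obtain ⟨f, hf⟩ := third p q fun h => h4 (by rw [h])
  refine ⟨f, fun i => ?_⟩
  rw [← hf]
  constructor
  · intro h
    exact ⟨fun e => h1 (e ▸ h), fun e => h2 (e ▸ h)⟩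
  · rintro ⟨hp, hq⟩
    by_contra hi
    rcases h5 (v, i) hi rfl with h | h
    · exact hp (congrArg Prod.snd h)
    · exact hq (congrArg Prod.snd h)

theorem IsCircuitComponent.arr_unique (h : IsCircuitComponent G γ) {i : ℕ} {w : List Turn}
    {z : V × ZMod 3} (hw : G.Arr (G.mate (cyclicGet γ h.circuit.1.1 i)) w z) :
    w = threadWord G (cyclicGet γ h.circuit.1.1) i w.length := by
  induction w generalizing i with
  | nil => rfl
  | cons t w ih =>
    have hT := h.circuit.1.isThread
    obtain ⟨h1, h2⟩ := hw
    have e : exitSlot (G.mate (cyclicGet γ h.circuit.1.1 i)) t =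
        cyclicGet γ h.circuit.1.1 (i + 1) := by
      refine (h.eq_or_eq i h1 ?_).resolve_right (exitSlot_ne _ _)
      rw [exitSlot_fst, hT.fst]
    have et : t = G.turn (cyclicGet γ h.circuit.1.1 i) (cyclicGet γ h.circuit.1.1 (i + 1)) := by
      rw [← e, turn_exitSlot]
    rw [e] at h2
    have h3 := ih h2
    rw [List.length_cons, threadWord, List.range_succ_eq_map, List.map_cons, List.map_map]
    congr 1
    rw [h3]
    simp [threadWord, Function.comp_def, add_assoc, add_comm, add_left_comm]

/-- A path in the direction of the circuit has no choice, so when closed it winds around a whole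
number of times and begins with a rotation of the word of `γ`. -/
theorem IsCircuitComponent.cost_word_le (h : IsCircuitComponent G γ) {i : ℕ} {w : List Turn}
    (hw : w ≠ []) (hs : G.Arr (G.mate (cyclicGet γ h.circuit.1.1 i)) w
      (G.mate (cyclicGet γ h.circuit.1.1 i))) : cost (G.word γ) ≤ cost w := by
  have hγ := h.circuit.1.1
  have hT := h.circuit.1.isThread
  have e := h.arr_unique hs
  have h1 := hT.arr i w.length
  rw [← e] at h1
  have h2 := congrArg G.mate (hs.unique h1)
  rw [G.mate_mate, G.mate_mate] at h2
  have h3 : i ≡ i + w.length [MOD γ.length] := h.circuit.mod_eq (congrArg Prod.fst h2)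
  have h4 : γ.length ≤ w.length := by
    refine Nat.le_of_dvd (List.length_pos_of_ne_nil hw) ?_
    exact (Nat.modEq_zero_iff_dvd.1 (Nat.ModEq.add_left_cancel' i h3.symm))
  have h5 : (G.word γ).rotate i = threadWord G (cyclicGet γ hγ) i γ.length := by
    rw [h.circuit.1.word_eq]
    refine List.ext_getElem (by simp) fun j h6 h7 => ?_
    simp only [List.getElem_rotate, threadWord, List.getElem_map, List.getElem_range,
      List.length_map, List.length_range, zero_add]
    rw [cyclicGet_congr hγ (i := (j + i) % γ.length) (j := i + j) (by simp [add_comm]),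
      cyclicGet_congr hγ (i := (j + i) % γ.length + 1) (j := i + j + 1) (by simp [add_comm])]
  rw [← cost_rotate (G.word γ) i, h5, e]
  exact cost_mono ((List.range_sublist.2 h4).map _)

end IsCircuitComponent

/-- If all components are circuits of trace at least `k`, then all cycles have cost at least `k`. -/
theorem ComponentsAreCircuits.cyclesCost (hG : G.ComponentsAreCircuits) {k : ℤ} (hk : 3 ≤ k)
    (h : ∀ γ, G.IsCircuit γ → k ≤ wordTrace (G.word γ)) : CyclesCost k G := by
  intro s w hw hs
  obtain ⟨hs1, hs2⟩ := hs.exit hw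
  obtain ⟨γ, h1, h2, h3⟩ := hG s.1
  have hC : IsCircuitComponent G γ := ⟨h1, fun d hd hv => h3 d hd hv⟩
  have hcost : k ≤ cost (G.word γ) := by
    have hk' := h γ h1
    -- A one-letter word has trace 2, below `k`.
    rw [cost, if_neg]
    · exact hk'
    · rw [wordTrace_eq] at hk'
      rintro (hp | hp)
      · rw [wordMat_of_pure_left hp] at hk'; simp at hk'; omega
      · rw [wordMat_of_pure_right hp] at hk'; simp at hk'; omega
  -- The path runs against the chosen direction of the circuit or along it; the first case is
  -- reversed.
  rcases h3 s hs1 h2 with h4 | h4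
  · obtain ⟨i, hi⟩ := (mem_iff_cyclicGet h1.1.1).1 h4
    rw [← cost_rev]
    refine hcost.trans (hC.cost_word_le (i := i) (by simpa [rev] using hw) ?_)
    rw [hi]
    exact hs2.rev.arr hs1
  · obtain ⟨i, hi⟩ := (mem_iff_cyclicGet h1.1.1).1 h4
    refine hcost.trans (hC.cost_word_le (i := i) hw ?_)
    rwa [hi, G.mate_mate]

end OrientedGraph

/-! ### Completions as involutions of the vertex set, whose fixed points are the slots still empty.
-/

namespace OrientedGraph

open Turn

variable {V : Type*}

section Completion

variable (H : OrientedGraph V) (f : V → ZMod 3) (hf : ∀ v, H.mate (v, f v) = (v, f v))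

/-- The graph that arises by joining the empty slots `(v, f v)` and `(σ v, f (σ v))` for all
vertices `v` that are not fixed by the involution `σ`. -/
def completion (σ : V → V) (hσ : Function.Involutive σ) : OrientedGraph V where
  mate d := if d.2 = f d.1 then (σ d.1, f (σ d.1)) else H.mate d
  mate_mate d := by
    by_cases h : d.2 = f d.1
    · simp only [if_pos h]
      rw [if_pos trivial, hσ d.1, ← h]
    · simp only [if_neg h]
      rw [if_neg, H.mate_mate]
      intro h'
      have h1 : H.mate d = ((H.mate d).1, f (H.mate d).1) := by rw [← h']
      have h2 := hf (H.mate d).1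
      rw [← h1, H.mate_mate] at h2
      rw [← h2] at h'
      exact h h'

variable {H f} {σ τ : V → V} {hσ : Function.Involutive σ} {hτ : Function.Involutive τ}

theorem completion_mate (v : V) : (completion H f hf σ hσ).mate (v, f v) = (σ v, f (σ v)) := by
  simp [completion]

theorem completion_mate_of_ne {d : V × ZMod 3} (hd : d.2 ≠ f d.1) :
    (completion H f hf σ hσ).mate d = H.mate d := by
  simp [completion, hd]

theorem completion_id (hid : Function.Involutive (id : V → V)) : completion H f hf id hid = H := by
  have h : (completion H f hf id hid).mate = H.mate := by
    funext d
    by_cases h : d.2 = f d.1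
    · obtain ⟨v, i⟩ := d
      obtain rfl : i = f v := h
      rw [completion_mate, hf]; rfl
    · exact completion_mate_of_ne hf h
  generalize completion H f hf id hid = G at h
  cases G; cases H
  cases h
  rfl

theorem isCompletedBy_completion : H.IsCompletedBy (completion H f hf σ hσ) := by
  rintro ⟨v, i⟩ hd
  refine completion_mate_of_ne hf fun h => hd ?_
  obtain rfl : i = f v := h
  exact hf v

theorem isTrivalent_completion (hf' : ∀ v i, H.mate (v, i) = (v, i) → i = f v)
    (h : ∀ v, σ v ≠ v) : (completion H f hf σ hσ).IsTrivalent := by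
  rintro ⟨v, i⟩
  by_cases hi : i = f v
  · subst hi
    rw [IsHalfEdge, completion_mate]
    exact fun e => h v (congrArg Prod.fst e)
  · rw [IsHalfEdge, completion_mate_of_ne hf hi]
    exact fun e => hi (hf' v i e)

theorem isLink_completion {a b : V} (hab : a ≠ b) (ha : σ a = a) (hb : σ b = b) (h : τ a = b)
    (hother : ∀ v, v ≠ a → v ≠ b → τ v = σ v) :
    IsLink (completion H f hf σ hσ) (completion H f hf τ hτ) (a, f a) (b, f b) where
  left_empty := by rw [completion_mate, ha]
  right_empty := by rw [completion_mate, hb]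
  ne e := hab (congrArg Prod.fst e)
  left := by rw [completion_mate, h]
  other := by
    rintro ⟨v, i⟩ h1 h2
    by_cases hi : i = f v
    · subst hi
      rw [completion_mate, completion_mate, hother v (fun e => h1 (by rw [e]))
        (fun e => h2 (by rw [e]))]
    · rw [completion_mate_of_ne hf hi, completion_mate_of_ne hf hi]

end Completion

section Involution

variable [DecidableEq V] {σ : V → V} {a b : V}

theorem involutive_comp_swap (hσ : Function.Involutive σ) (ha : σ a = a) (hb : σ b = b) :
    Function.Involutive (σ ∘ Equiv.swap a b) := by
  intro v
  have h1 := hσ v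
  simp only [Function.comp, Equiv.swap_apply_def]
  have h2 (h : σ v = a) : v = a := by rw [← h1, h, ha]
  have h3 (h : σ v = b) : v = b := by rw [← h1, h, hb]
  grind

theorem involutive_comp_swap' (hσ : Function.Involutive σ) (h : σ a = b) :
    Function.Involutive (σ ∘ Equiv.swap a b) := by
  intro v
  have h1 := hσ v
  have h2 := hσ a
  simp only [Function.comp, Equiv.swap_apply_def]
  have h3 (h' : σ v = a) : v = b := by rw [← h1, h', h]
  have h4 (h' : σ v = b) : v = a := by rw [← h1, h', ← h, h2]
  grind

theorem exists_ne_fixed [Fintype V] (hσ : Function.Involutive σ) (hV : Even (Fintype.card V))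
    (ha : σ a = a) : ∃ b, b ≠ a ∧ σ b = b := by
  by_contra! h
  have h1 := Equiv.Perm.card_fixedPoints_modEq (α := V) (f := (σ : Function.End V)) (p := 2)
    (n := 1) (by funext v; exact hσ v)
  have h2 : Fintype.card (Function.fixedPoints σ) = 1 := by
    rw [Fintype.card_eq_one_iff]
    exact ⟨⟨a, ha⟩, fun ⟨b, hb⟩ => Subtype.ext (by_contra fun hne => h b hne hb)⟩
  have h3 : Fintype.card V ≡ 1 [MOD 2] := by
    refine h1.trans ?_
    rw [← h2]
  rw [Nat.ModEq, Nat.even_iff.1 hV] at h3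
  simp at h3

end Involution

/-! ### Balls in the cost and the filling of the empty slots. -/

/-- The vertices that are reached from the slot `s` along words of cost at most `m`. -/
def reach (G : OrientedGraph V) (s : V × ZMod 3) (m : ℕ) : Set V :=
  {v | ∃ w z, cost w ≤ m ∧ G.Arr s w z ∧ z.1 = v}

theorem ncard_reach_le (G : OrientedGraph V) (s : V × ZMod 3) (m : ℕ) :
    (G.reach s m).ncard ≤ traceCountSum m + 2 * m + 1 := by
  classical
  obtain ⟨hfin, hcard⟩ := finite_ncard_cost_le m
  let g (w : List Turn) : V := if h : ∃ z, G.Arr s w z then h.choose.1 else s.1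
  have hsub : G.reach s m ⊆ g '' {w | cost w ≤ m} := by
    rintro v ⟨w, z, hw, hz, rfl⟩
    refine ⟨w, hw, ?_⟩
    have h : ∃ z, G.Arr s w z := ⟨z, hz⟩
    simp only [g, dif_pos h]
    rw [h.choose_spec.unique hz]
  exact (Set.ncard_le_ncard hsub (hfin.image g)).trans ((Set.ncard_image_le hfin).trans hcard)

theorem mem_reach_self (G : OrientedGraph V) (s : V × ZMod 3) (m : ℕ) : s.1 ∈ G.reach s m :=
  ⟨[], s, by rw [cost_pure (t := left) (by simp [Turn.Pure])]; simp, rfl, rfl⟩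

theorem lt_cost_of_arr {G : OrientedGraph V} {s z : V × ZMod 3} {m : ℕ} {w : List Turn}
    (hz : z.1 ∉ G.reach s m) (h : G.Arr s w z) : (m : ℤ) < cost w := by
  by_contra! hw
  exact hz ⟨w, z, hw, h, rfl⟩

theorem lt_cost_of_exit {G : OrientedGraph V} {s b : V × ZMod 3} {m : ℕ} {w : List Turn}
    (hb : b.1 ∉ G.reach s m) (h : G.Exit s w b) : (m : ℤ) + 1 < cost w := by
  obtain ⟨v, t, z, rfl, h1, rfl⟩ := h.concat
  have := lt_cost_of_arr (by simpa using hb) h1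
  linarith [cost_concat v t]

/-- Two finite sets that are small in comparison with `V` have a common exterior point whose image
under a given injection is not in both sets. -/
theorem exists_notMem_union {V : Type*} [Fintype V] {S T : Set V} {σ : V → V}
    (hσ : Function.Injective σ) (h : S.ncard + T.ncard < Fintype.card V) :
    ∃ x, x ∉ S ∧ x ∉ T ∧ ¬ (σ x ∈ S ∧ σ x ∈ T) := by
  by_contra! hx
  have h1 : (S ∪ T)ᶜ.ncard ≤ (S ∩ T).ncard := by
    refine Set.ncard_le_ncard_of_injOn σ (fun x hx' => ?_) hσ.injOn (Set.toFinite _)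
    simp only [Set.mem_compl_iff, Set.mem_union, not_or] at hx'
    exact hx x hx'.1 hx'.2
  have h2 := Set.ncard_add_ncard_compl (S ∪ T)
  have h3 := Set.ncard_union_add_ncard_inter S T
  rw [Nat.card_eq_fintype_card] at h2
  omega

theorem exists_completion_fewer_fixed [Fintype V] {H : OrientedGraph V} {f : V → ZMod 3}
    (hf : ∀ v, H.mate (v, f v) = (v, f v)) {σ : V → V} (hσ : Function.Involutive σ) {m : ℕ}
    (hG : CyclesCost (m + 2) (completion H f hf σ hσ))
    (hcard : 2 * (traceCountSum m + 2 * m + 1) < Fintype.card V) {a₁ a₂ : V} (ha : a₁ ≠ a₂)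
    (h₁ : σ a₁ = a₁) (h₂ : σ a₂ = a₂) :
    ∃ (τ : V → V) (hτ : Function.Involutive τ), CyclesCost (m + 2) (completion H f hf τ hτ) ∧
      {v | τ v = v} ⊂ {v | σ v = v} := by
  classical
  set G := completion H f hf σ hσ with hGdef
  have hr1 := G.ncard_reach_le (a₁, f a₁) m
  have hr2 := G.ncard_reach_le (a₂, f a₂) m
  obtain ⟨x, hx1, hx2, hx⟩ := exists_notMem_union (S := G.reach (a₁, f a₁) m)
    (T := G.reach (a₂, f a₂) m) hσ.injective (by omega)
  have hxa1 : x ≠ a₁ := by rintro rfl; exact hx1 (G.mem_reach_self (x, f x) m)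
  have hxa2 : x ≠ a₂ := by rintro rfl; exact hx2 (G.mem_reach_self (x, f x) m)
  by_cases hσx : σ x = x
  · refine ⟨_, involutive_comp_swap hσ h₁ hσx, ?_, ?_⟩
    · refine IsLink.cyclesCost (a := (a₁, f a₁)) (b := (x, f x))
        (isLink_completion (hσ := hσ) hf hxa1.symm h₁ hσx ?_ ?_) hG fun w hw => ?_
      · simp [hσx]
      · intro v hv1 hv2
        simp [Equiv.swap_apply_of_ne_of_ne hv1 hv2]
      · have := lt_cost_of_exit (m := m) (by exact hx1) hw
        omega
    · refine (Set.ssubset_iff_of_subset fun v hv => ?_).2 ⟨a₁, h₁, ?_⟩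
      · simp only [Set.mem_ofPred_eq, Function.comp, Equiv.swap_apply_def] at hv ⊢
        grind
      · simp [hσx, hxa1]
  -- Stated for either order of the two empty slots, so that `a₂` can be the one whose ball misses
  -- `σ x`.
  have key (a₁ a₂ : V) (ha : a₁ ≠ a₂) (h₁ : σ a₁ = a₁) (h₂ : σ a₂ = a₂) (hxa1 : x ≠ a₁)
      (hxa2 : x ≠ a₂)
      (hx1 : x ∉ G.reach (a₁, f a₁) m) (hx2 : x ∉ G.reach (a₂, f a₂) m)
      (hy : σ x ∉ G.reach (a₂, f a₂) m) :
      ∃ (τ : V → V) (hτ : Function.Involutive τ), CyclesCost (m + 2) (completion H f hf τ hτ) ∧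
        {v | τ v = v} ⊂ {v | σ v = v} := by
    obtain ⟨y, hxy⟩ : ∃ y, σ x = y := ⟨_, rfl⟩
    have hyx : σ y = x := by rw [← hxy, hσ]
    rw [hxy] at hσx hy
    have hya1 : y ≠ a₁ := by rintro rfl; exact hσx (by rw [← hyx, h₁])
    have hya2 : y ≠ a₂ := by rintro rfl; exact hσx (by rw [← hyx, h₂])
    obtain ⟨σ₀, hσ₀⟩ : ∃ σ₀, σ₀ = σ ∘ Equiv.swap x y := ⟨_, rfl⟩
    obtain ⟨σ₁, hσ₁⟩ : ∃ σ₁, σ₁ = σ₀ ∘ Equiv.swap a₁ x := ⟨_, rfl⟩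
    obtain ⟨σ₂, hσ₂⟩ : ∃ σ₂, σ₂ = σ₁ ∘ Equiv.swap a₂ y := ⟨_, rfl⟩
    have e0 (v : V) : σ₀ v = if v = x then x else if v = y then y else σ v := by
      rw [hσ₀]; simp only [Function.comp, Equiv.swap_apply_def]; grind
    have e1 (v : V) : σ₁ v = if v = a₁ then x else if v = x then a₁ else σ₀ v := by
      rw [hσ₁]; simp only [Function.comp, Equiv.swap_apply_def]; grind
    have e2 (v : V) : σ₂ v = if v = a₂ then y else if v = y then a₂ else σ₁ v := by
      rw [hσ₂]; simp only [Function.comp, Equiv.swap_apply_def]; grind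
    have i0 : Function.Involutive σ₀ := hσ₀ ▸ involutive_comp_swap' hσ hxy
    have i1 : Function.Involutive σ₁ := hσ₁ ▸ involutive_comp_swap i0 (by grind) (by grind)
    have i2 : Function.Involutive σ₂ := hσ₂ ▸ involutive_comp_swap i1 (by grind) (by grind)
    refine ⟨σ₂, i2, ?_, ?_⟩
    · refine CyclesCost.switch (a₁ := (a₁, f a₁)) (a₂ := (a₂, f a₂)) (x := (x, f x))
        (y := (y, f y)) hG
        (isLink_completion (hσ := i0) hf ?_ ?_ ?_ ?_ ?_)
        (isLink_completion (hτ := i1) hf ?_ ?_ ?_ ?_ ?_)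
        (isLink_completion hf ?_ ?_ ?_ ?_ ?_) ?_ ?_ ?_ ?_
      rotate_right 4
      · intro w hw
        have := lt_cost_of_exit (m := m) (by exact hx1) hw
        omega
      · intro w hw
        have := lt_cost_of_exit (m := m) (by exact hx2) hw
        omega
      · intro w hw
        have := lt_cost_of_exit (m := m) (by exact hy) hw
        omega
      · intro w hw
        have hh : G.IsHalfEdge (y, f y) := by
          rw [IsHalfEdge, hGdef, completion_mate, hyx]
          exact fun e => hσx (congrArg Prod.fst e).symm
        -- Leaving through `y` leads along the edge to `x`, outside the ball of `a₁`; this gives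
        -- cost at least `m + 1 = k - 1`.
        have := lt_cost_of_arr (m := m) (by rw [hGdef, completion_mate, hyx]; exact hx1)
          (hw.arr hh)
        omega
      all_goals grind
    · refine (Set.ssubset_iff_of_subset fun v hv => ?_).2 ⟨a₁, h₁, ?_⟩
      · simp only [Set.mem_ofPred_eq] at hv ⊢
        grind
      · simp only [Set.mem_ofPred_eq]
        grind
  by_cases hy : σ x ∈ G.reach (a₂, f a₂) m
  · exact key a₂ a₁ ha.symm h₂ h₁ hxa2 hxa1 hx2 hx1 fun h => hx ⟨h, hy⟩
  · exact key a₁ a₂ ha h₁ h₂ hxa1 hxa2 hx1 hx2 hy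

theorem exists_trivalent_completion [Fintype V] {H : OrientedGraph V} {f : V → ZMod 3}
    (hf : ∀ v, H.mate (v, f v) = (v, f v)) (hf' : ∀ v i, H.mate (v, i) = (v, i) → i = f v) {m : ℕ}
    (hH : CyclesCost (m + 2) H) (heven : Even (Fintype.card V))
    (hcard : 2 * (traceCountSum m + 2 * m + 1) < Fintype.card V) :
    ∃ G : OrientedGraph V, H.IsCompletedBy G ∧ G.IsTrivalent ∧ CyclesCost (m + 2) G := by
  classical
  suffices ∀ (n : ℕ) (σ : V → V) (hσ : Function.Involutive σ), {v | σ v = v}.ncard = n →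
      CyclesCost (m + 2) (completion H f hf σ hσ) →
      ∃ G : OrientedGraph V, H.IsCompletedBy G ∧ G.IsTrivalent ∧ CyclesCost (m + 2) G from
    this _ id (show Function.Involutive id from fun _ => rfl) rfl (by rwa [completion_id])
  intro n
  induction n using Nat.strong_induction_on with
  | _ n ih =>
    intro σ hσ hn hG
    by_cases h : ∀ v, σ v ≠ v
    · exact ⟨_, isCompletedBy_completion hf, isTrivalent_completion hf hf' h, hG⟩
    push Not at h
    obtain ⟨a₁, h₁⟩ := h
    obtain ⟨a₂, ha, h₂⟩ := exists_ne_fixed hσ heven h₁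
    obtain ⟨τ, hτ, h3, h4⟩ := exists_completion_fewer_fixed hf hσ hG hcard ha.symm h₁ h₂
    exact ih _ (hn ▸ Set.ncard_lt_ncard h4 (Set.toFinite _)) τ hτ rfl h3

/-! ### From cost to trace, cusps and girth. -/

theorem CyclesCost.le_wordTrace {G : OrientedGraph V} {k : ℤ} (hG : CyclesCost k G)
    {γ : List (V × ZMod 3)} (h : G.IsCycle γ) (hl : ¬ Pure left (G.word γ))
    (hr : ¬ Pure right (G.word γ)) : k ≤ wordTrace (G.word γ) := by
  obtain ⟨s, h1, h2⟩ := h.arr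
  have := hG s _ h1 h2
  rwa [cost_mixed hl hr, ← wordTrace_eq] at this

theorem CyclesCost.le_length_of_pure {G : OrientedGraph V} {k : ℕ} (hG : CyclesCost k G)
    {γ : List (V × ZMod 3)} (h : G.IsCycle γ) {t : Turn} (ht : Pure t (G.word γ)) :
    k ≤ γ.length := by
  obtain ⟨s, h1, h2⟩ := h.arr
  have := hG s _ h1 h2
  rw [cost_pure ht, length_word] at this
  exact_mod_cast this

theorem CyclesCost.logb_le_girth {G : OrientedGraph V} {k : ℕ} (hk : 2 ≤ k)
    (hG : CyclesCost k G) :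
    ((⌈Real.logb Real.goldenRatio ((k : ℝ) - 1)⌉₊ : ℕ) : ℕ∞) ≤ G.girth := by
  refine le_iInf₂ fun γ (hγ : G.IsCircuit γ) => ?_
  rw [Nat.cast_le, Nat.ceil_le]
  have hk' : (2 : ℝ) ≤ k := by exact_mod_cast hk
  rw [Real.logb_le_iff_le_rpow Real.one_lt_goldenRatio (by linarith), Real.rpow_natCast]
  have hpure (t : Turn) (ht : Pure t (G.word γ)) :
      (k : ℝ) - 1 ≤ Real.goldenRatio ^ γ.length := by
    have h1 := hG.le_length_of_pure hγ.1 ht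
    have h2 : (1 : ℝ) ≤ γ.length := by exact_mod_cast (by omega : 1 ≤ γ.length)
    -- The word `L R ^ (l - 1)` has length `l` and trace `l + 1`, which yields `l ≤ φ ^ l`.
    have h3 := wordTrace_le (left :: List.replicate (γ.length - 1) right)
    rw [wordTrace_eq, wordMat_left_cons, wordMat_replicate_right] at h3
    have h4 : (k : ℝ) ≤ γ.length := by exact_mod_cast h1
    rw [List.length_cons, List.length_replicate, Nat.sub_add_cancel (by omega)] at h3
    simp [Nat.cast_sub (show 1 ≤ γ.length by omega)] at h3
    linarith
  by_cases hl : Pure left (G.word γ)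
  · exact hpure _ hl
  by_cases hr : Pure right (G.word γ)
  · exact hpure _ hr
  have h1 : (k : ℝ) ≤ wordTrace (G.word γ) := by exact_mod_cast hG.le_wordTrace hγ.1 hl hr
  have h2 := wordTrace_le (G.word γ)
  rw [length_word] at h2
  linarith

end OrientedGraph

open OrientedGraph in
theorem theorem4p1 {V : Type*} [Fintype V] (k : ℕ) (hk : 3 ≤ k) (H : OrientedGraph V)
    (hcomp : H.ComponentsAreCircuits)
    (htrace : ∀ γ, H.IsCircuit γ → (k : ℤ) ≤ Turn.wordTrace (H.word γ))
    (heven : Even (Fintype.card V))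
    (hcard : 2 * Turn.traceCountSum (k - 2) + 4 * k - 4 ≤ Fintype.card V) :
    ∃ H' : OrientedGraph V, H.IsCompletedBy H' ∧ H'.IsTrivalent ∧
      (∀ γ, H'.IsCycle γ → H'.IsEssential γ → ¬ H'.IsPeripheral γ →
        (k : ℤ) ≤ Turn.wordTrace (H'.word γ)) ∧
      ((⌈Real.logb Real.goldenRatio ((k : ℝ) - 1)⌉₊ : ℕ) : ℕ∞) ≤ H'.girth ∧
      ∀ γ, H'.IsCusp γ → k ≤ γ.length := by
  have hH := hcomp.cyclesCost (by exact_mod_cast hk) htrace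
  have hslot (v : V) : ∃ f, ∀ i, H.mate (v, i) = (v, i) ↔ i = f := by
    obtain ⟨γ, h1, h2, h3⟩ := hcomp v
    exact IsCircuitComponent.exists_empty_slot ⟨h1, h3⟩ h2
  choose f hf using hslot
  obtain ⟨m, rfl⟩ : ∃ m, k = m + 2 := ⟨k - 2, by omega⟩
  rw [Nat.add_sub_cancel] at hcard
  -- With `k = m + 2` the assumed bound equals `2 (N(m) + 2m + 1) + 2`, more than two balls can
  -- hold.
  obtain ⟨G, h1, h2, h3⟩ := exists_trivalent_completion (fun v => (hf v _).2 rfl)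
    (fun v i => (hf v i).1) (m := m) (by exact_mod_cast hH) heven (by omega)
  have h3 : CyclesCost ((m + 2 : ℕ) : ℤ) G := by exact_mod_cast h3
  refine ⟨G, h1, h2, fun γ hγ _ hp => h3.le_wordTrace hγ ?_ ?_, h3.logb_le_girth (by omega),
    fun γ hγ => h3.le_length_of_pure hγ.1 hγ.2.1⟩
  · exact fun hl => hp ⟨γ, hγ, Or.inl hl, Relation.EqvGen.refl _⟩
  · exact fun hr => hp ⟨γ, hγ, Or.inr hr, Relation.EqvGen.refl _⟩
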